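/- Let $\Sigma\in\mathbb R^{d\times d}$ be positive semidefinite, let $x\sim\mathcal N(0,\Sigma)$ be a centered Gaussian vector in $\mathbb R^d$, let $w_1^*,\dots,w_k^*\in\mathbb R^d$ be such that $\Sigma^{1/2}w_1^*,\dots,\Sigma^{1/2}w_k^*$ are orthonormal, and put $\eta_i=\langle w_i^*,x\rangle$. Let $\xi$ be a real random variable independent of $x$ with $\mathbb E[\xi]=0$, $\mathbb E[\xi^2]>0$ and $\mathbb E[\xi^8]<\infty$. Let $l\ge 1$ be an integer, let $m,s$ be real polynomials in $k$ variables, each of (total) degree at most $l$, and let $$y=m(\eta_1,\dots,\eta_k)+s(\eta_1,\dots,\eta_k)\cdot\xi\quad\text{almost surely}.$$ Then for all $w\in\mathbb R^d$ and $b\in\mathbb R$ the residual $\langle w,x\rangle+b-y$ has a finite eighth moment and $$\frac{\mathbb E\big[(\langle w,x\rangle+b-y)^8\big]^{1/8}}{\mathbb E\big[(\langle w,x\rangle+b-y)^2\big]^{1/2}}\;\le\;\sqrt2\cdot\sqrt7^{\,l}\cdot\frac{\mathbb E[\xi^8]^{1/8}}{\mathbb E[\xi^2]^{1/2}},$$ where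 the left-hand side is read as $0$ in the trivial case that the residual vanishes almost surely. -/

import Mathlib

open MeasureTheory ProbabilityTheory
open scoped MatrixOrder

/-- The multi-index model on a probability space `(Ω, P)`: the feature vector `x` is a centered
Gaussian vector in `ℝ^d` with covariance matrix `S`, the vectors `S^{1/2} wstar i` are orthonormal,
the noise `ξ` is a real random variable independent of `x`, and the label is
`y = g (η_1, …, η_k) ξ` almost surely, where `η_i = ⟨wstar i, x⟩`. -/
structure IsMultiIndexModel {Ω : Type*} [MeasurableSpace Ω] (P : Measure Ω) {d k : ℕ}
    (S : Matrix (Fin d) (Fin d) ℝ) (wstar : Fin k → EuclideanSpace ℝ (Fin d))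
    (g : (Fin k → ℝ) → ℝ → ℝ) (x : Ω → EuclideanSpace ℝ (Fin d)) (ξ y : Ω → ℝ) : Prop where
  posSemidef : S.PosSemidef
  law_x : HasLaw x (multivariateGaussian 0 S) P
  orthonormal : Orthonormal ℝ fun i => Matrix.toEuclideanCLM (𝕜 := ℝ) (CFC.sqrt S) (wstar i)
  aemeasurable_noise : AEMeasurable ξ P
  indep : IndepFun x ξ P
  label_eq : ∀ᵐ ω ∂P, y ω = g (fun i => inner ℝ (wstar i) (x ω)) (ξ ω)

/-! The residual is `u - c ξ` with `u = ⟨w, x⟩ + b - m(η)` and `c = s(η)`, both polynomials of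
degree at most `l` in a Gaussian vector. Hypercontractivity bounds their L⁸ norms by `√7 ^ l` times
their L² norms. Independence and the centering of `ξ` give the second moment `E u² + E c² · E ξ²`,
while Minkowski bounds the L⁸ norm by `√7 ^ l (‖u‖₂ + ‖c‖₂ ‖ξ‖₈)`. Comparing the two uses `‖ξ‖₂ ≤
‖ξ‖₈` and `√a + √b ≤ √2 √(a + b)`.

Hypercontractivity is proved for linear functionals on polynomials. It holds for evaluation at the
origin and survives averaging over opposite translations (`IsHypercontractive.symmetrize`), that is,
adding independent random signs. The moments of a rescaled random walk converge to Gaussian ones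
(`tendsto_walkMoment`), and the inequality passes to the limit, one coordinate at a time
(`isHypercontractive_momentFunctional`). -/

namespace MvPolynomial

/-! ### Translations of polynomials and degrees -/

variable {σ τ : Type*}

/-- Translation `p ↦ p (X + v)` of a polynomial. -/
noncomputable def translate (v : σ → ℝ) : MvPolynomial σ ℝ →ₐ[ℝ] MvPolynomial σ ℝ :=
  aeval fun i => X i + C (v i)

lemma totalDegree_aeval_le {p : MvPolynomial σ ℝ} {f : σ → MvPolynomial τ ℝ} {l : ℕ}
    (hp : p.totalDegree ≤ l) (hf : ∀ i, (f i).totalDegree ≤ 1) :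
    (aeval f p).totalDegree ≤ l := by
  rw [aeval_def, eval₂_eq]
  refine totalDegree_finsetSum_le fun d hd => ?_
  refine (totalDegree_mul _ _).trans ?_
  rw [algebraMap_eq, totalDegree_C, zero_add]
  refine (totalDegree_finsetProd _ _).trans ?_
  refine le_trans ?_ ((le_totalDegree hd).trans hp)
  refine Finset.sum_le_sum fun i _ => (totalDegree_pow _ _).trans ?_
  simpa using Nat.mul_le_mul_left (d i) (hf i)

lemma totalDegree_translate_le (v : σ → ℝ) {p : MvPolynomial σ ℝ} {l : ℕ}
    (hp : p.totalDegree ≤ l) : (translate v p).totalDegree ≤ l :=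
  totalDegree_aeval_le hp fun i =>
    (totalDegree_add _ _).trans (by simp [totalDegree_X, totalDegree_C])

lemma translate_sub_self_of_totalDegree_eq_zero (v : σ → ℝ) {p : MvPolynomial σ ℝ}
    (hp : p.totalDegree = 0) : translate v p - p = 0 := by
  rw [totalDegree_eq_zero_iff_eq_C.1 hp]
  simp [translate, algebraMap_eq]

lemma totalDegree_translate_monomial_sub_le (v : σ → ℝ) (c : ℝ) {n : ℕ} {d : σ →₀ ℕ}
    (hd : d.degree ≤ n + 1) :
    (translate v (monomial d c) - monomial d c).totalDegree ≤ n := by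
  classical
  induction n generalizing d with
  | zero | succ n ih =>
    by_cases h0 : d = 0
    · rw [translate_sub_self_of_totalDegree_eq_zero v]
      · simp
      · simp [h0]
    obtain ⟨i, hi⟩ := Finsupp.ne_iff.1 h0
    obtain ⟨e, rfl⟩ : ∃ e, d = e + Finsupp.single i 1 :=
      ⟨d - Finsupp.single i 1, (tsub_add_cancel_of_le (by
        simpa [Nat.one_le_iff_ne_zero] using hi)).symm⟩
    rw [map_add, Finsupp.degree_single] at hd
    have hX : (X i : MvPolynomial σ ℝ).totalDegree = 1 := totalDegree_X i
    have hm := (totalDegree_translate_le v (totalDegree_monomial_le e c))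
    have key : translate v (monomial (e + Finsupp.single i 1) c) - monomial (e + Finsupp.single i 1) c
        = X i * (translate v (monomial e c) - monomial e c) + C (v i) * translate v (monomial e c) := by
      rw [monomial_add_single, pow_one, map_mul,
        show translate v (X i) = X i + C (v i) from aeval_X _ _]
      ring
    rw [key]
    refine (totalDegree_add _ _).trans (max_le ?_
      ((totalDegree_mul _ _).trans ?_))
    -- The first alternative is the inductive step; the second serves the base case, where `e` has
    -- degree `0` and the difference vanishes.
    · first
      | have := ih (d := e) (by omega)
        refine (totalDegree_mul _ _).trans ?_
        omega
      | rw [translate_sub_self_of_totalDegree_eq_zero v, mul_zero]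
        · simp
        exact Nat.le_zero.1 ((totalDegree_monomial_le e c).trans (by change e.degree ≤ _; omega))
    · rw [totalDegree_C]
      exact (zero_add _).trans_le (hm.trans (by change e.degree ≤ _; omega))

lemma totalDegree_translate_sub_self_le (v : σ → ℝ) {p : MvPolynomial σ ℝ} {l : ℕ}
    (hp : p.totalDegree ≤ l + 1) : (translate v p - p).totalDegree ≤ l := by
  have e : translate v p - p = ∑ d ∈ p.support,
      (translate v (monomial d (coeff d p)) - monomial d (coeff d p)) := by
    rw [Finset.sum_sub_distrib, ← map_sum, ← p.as_sum]
  rw [e]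
  exact totalDegree_finsetSum_le fun d hd =>
    totalDegree_translate_monomial_sub_le v _ ((le_totalDegree hd).trans hp)

/-! ### Hypercontractive functionals and the two-point step -/

/-- A linear functional on polynomials, thought of as an expectation, which is positive on squares
and satisfies the `L²`-`L⁸` hypercontractive inequality in every degree. -/
structure IsHypercontractive (L : MvPolynomial σ ℝ →ₗ[ℝ] ℝ) : Prop where
  sq_nonneg : ∀ p, 0 ≤ L (p ^ 2)
  le_pow : ∀ (l : ℕ) (p : MvPolynomial σ ℝ), p.totalDegree ≤ l →
    L (p ^ 8) ≤ 7 ^ (4 * l) * L (p ^ 2) ^ 4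

/-- Cauchy–Schwarz, by the discriminant of `t ↦ L ((p + t q)²)`. -/
lemma sq_map_mul_le (L : MvPolynomial σ ℝ →ₗ[ℝ] ℝ) (hL : ∀ p, 0 ≤ L (p ^ 2))
    (p q : MvPolynomial σ ℝ) : L (p * q) ^ 2 ≤ L (p ^ 2) * L (q ^ 2) := by
  have h : ∀ t : ℝ, 0 ≤ L (q ^ 2) * (t * t) + (2 * L (p * q)) * t + L (p ^ 2) := fun t => by
    have := hL (p + t • q)
    have e : (p + t • q) ^ 2 = p ^ 2 + (2 * t) • (p * q) + (t * t) • q ^ 2 := by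
      simp only [smul_eq_C_mul, map_mul, map_ofNat]; ring
    rw [e, map_add, map_add, map_smul, map_smul, smul_eq_mul, smul_eq_mul] at this
    linarith
  have := discrim_le_zero h
  rw [discrim] at this
  linarith

/-- Averaging a functional over the two translations by `v` and `-v`. -/
noncomputable def symmetrize (v : σ → ℝ) (L : MvPolynomial σ ℝ →ₗ[ℝ] ℝ) :
    MvPolynomial σ ℝ →ₗ[ℝ] ℝ :=
  (1 / 2 : ℝ) • (L ∘ₗ (translate v).toLinearMap + L ∘ₗ (translate (-v)).toLinearMap)

/-- The left side has the even binomial coefficients of an eighth power. The constant 7 is forced by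
the second term, `4 * 7 = 28`; the later coefficients have slack. -/
lemma two_point_bound {X Y Z U V x v : ℝ} (hx : 0 ≤ x) (hv : 0 ≤ v) (hX : X ≤ x ^ 4)
    (hV : V ≤ v ^ 4) (hV0 : 0 ≤ V) (hZ0 : 0 ≤ Z) (hZ : Z ^ 2 ≤ X * V)
    (hY : Y ^ 2 ≤ X * Z) (hU : U ^ 2 ≤ Z * V) :
    X + 28 * Y + 70 * Z + 28 * U + V ≤ (x + 7 * v) ^ 4 := by
  have hZ' : Z ≤ x ^ 2 * v ^ 2 := by
    refine le_of_sq_le_sq (hZ.trans ?_) (by positivity)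
    calc X * V ≤ x ^ 4 * v ^ 4 := by gcongr
      _ = _ := by ring
  have hY' : Y ≤ x ^ 3 * v := by
    refine le_of_sq_le_sq (hY.trans ?_) (by positivity)
    calc X * Z ≤ x ^ 4 * (x ^ 2 * v ^ 2) := by gcongr
      _ = _ := by ring
  have hU' : U ≤ x * v ^ 3 := by
    refine le_of_sq_le_sq (hU.trans ?_) (by positivity)
    calc Z * V ≤ (x ^ 2 * v ^ 2) * v ^ 4 := by gcongr
      _ = _ := by ring
  have h1 : 0 ≤ x ^ 2 * v ^ 2 := by positivity
  have h2 : 0 ≤ x * v ^ 3 := by positivity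
  have h3 : 0 ≤ v ^ 4 := by positivity
  have e : (x + 7 * v) ^ 4 = x ^ 4 + 28 * (x ^ 3 * v) + 294 * (x ^ 2 * v ^ 2) +
    1372 * (x * v ^ 3) + 2401 * v ^ 4 := by ring
  rw [e]
  linarith

/-- Write the two translates as `h + g` and `h - g`. Odd powers of `g` cancel, and the top-degree
part cancels in `g`, so `g` has smaller degree than the bound for `p`. That lost degree saves a
factor 7 against `h`, which is what `two_point_bound` spends. -/
lemma IsHypercontractive.symmetrize {L : MvPolynomial σ ℝ →ₗ[ℝ] ℝ} (hL : IsHypercontractive L)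
    (v : σ → ℝ) : IsHypercontractive (symmetrize v L) := by
  refine ⟨fun p => ?_, fun l p hp => ?_⟩
  · have h1 := hL.sq_nonneg (translate v p)
    have h2 := hL.sq_nonneg (translate (-v) p)
    simp only [MvPolynomial.symmetrize, LinearMap.smul_apply, LinearMap.add_apply,
      LinearMap.comp_apply, AlgHom.toLinearMap_apply, map_pow, smul_eq_mul]
    linarith
  set h : MvPolynomial σ ℝ := C (1 / 2) * (translate v p + translate (-v) p) with hh
  set g : MvPolynomial σ ℝ := C (1 / 2) * (translate v p - translate (-v) p) with hg
  have two : (C (1 / 2) * 2 : MvPolynomial σ ℝ) = 1 := by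
    rw [← map_ofNat C 2, ← map_mul]; norm_num
  have e1 : translate v p = h + g := by
    rw [hh, hg]; linear_combination (-translate v p) * two
  have e2 : translate (-v) p = h - g := by
    rw [hh, hg]; linear_combination (-translate (-v) p) * two
  have eL : ∀ q, MvPolynomial.symmetrize v L q =
      (1 / 2) * (L (translate v q) + L (translate (-v) q)) := fun q => rfl
  have l2 : MvPolynomial.symmetrize v L (p ^ 2) = L (h ^ 2) + L (g ^ 2) := by
    rw [eL, map_pow (translate v), map_pow (translate (-v)), e1, e2, ← map_add,
      show (h + g) ^ 2 + (h - g) ^ 2 = (2 : ℝ) • (h ^ 2 + g ^ 2) by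
        simp only [smul_eq_C_mul, map_ofNat]; ring, map_smul, map_add, smul_eq_mul]
    ring
  have l8 : MvPolynomial.symmetrize v L (p ^ 8) = L (h ^ 8) + 28 * L (h ^ 4 * (h ^ 2 * g ^ 2)) +
      70 * L (h ^ 4 * g ^ 4) + 28 * L ((h ^ 2 * g ^ 2) * g ^ 4) + L (g ^ 8) := by
    rw [eL, map_pow (translate v), map_pow (translate (-v)), e1, e2, ← map_add,
      show (h + g) ^ 8 + (h - g) ^ 8 = (2 : ℝ) • (h ^ 8 + (28 : ℝ) • (h ^ 4 * (h ^ 2 * g ^ 2)) +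
        (70 : ℝ) • (h ^ 4 * g ^ 4) + (28 : ℝ) • ((h ^ 2 * g ^ 2) * g ^ 4) + g ^ 8) by
        simp only [smul_eq_C_mul, map_ofNat]; ring]
    simp only [map_smul, map_add, smul_eq_mul]
    ring
  have hC : ∀ q : MvPolynomial σ ℝ, (C (1 / 2) * q).totalDegree ≤ q.totalDegree := fun q =>
    (totalDegree_mul _ _).trans (by rw [totalDegree_C, zero_add])
  have dh : h.totalDegree ≤ l := (hC _).trans ((totalDegree_add _ _).trans
    (max_le (totalDegree_translate_le _ hp) (totalDegree_translate_le _ hp)))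
  have eg : translate v p - translate (-v) p = (translate v p - p) - (translate (-v) p - p) := by
    ring
  have Bh := hL.le_pow l h dh
  have h2 := hL.sq_nonneg h
  have g2 := hL.sq_nonneg g
  rw [l2, l8]
  cases l with
  | zero =>
    have : g = 0 := by
      have h0 := Nat.le_zero.1 hp
      rw [hg, eg, translate_sub_self_of_totalDegree_eq_zero v h0,
        translate_sub_self_of_totalDegree_eq_zero (-v) h0, sub_zero, mul_zero]
    rw [this]
    simpa using Bh
  | succ l =>
    have dg : g.totalDegree ≤ l := (hC _).trans <| by
      rw [eg]
      exact (totalDegree_sub _ _).trans (max_le (totalDegree_translate_sub_self_le _ hp)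
        (totalDegree_translate_sub_self_le _ hp))
    have Bg := hL.le_pow l g dg
    have p8 : ∀ q : MvPolynomial σ ℝ, 0 ≤ L (q ^ 8) := fun q => by
      rw [show q ^ 8 = (q ^ 4) ^ 2 by ring]
      exact hL.sq_nonneg _
    have c1 := sq_map_mul_le L hL.sq_nonneg (h ^ 4) (g ^ 4)
    have c2 := sq_map_mul_le L hL.sq_nonneg (h ^ 4) (h ^ 2 * g ^ 2)
    have c3 := sq_map_mul_le L hL.sq_nonneg (h ^ 2 * g ^ 2) (g ^ 4)
    have hZ0 := hL.sq_nonneg (h ^ 2 * g ^ 2)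
    simp only [← pow_mul, Nat.reduceMul] at c1 c2 c3
    have hZ : (h ^ 2 * g ^ 2) ^ 2 = h ^ 4 * g ^ 4 := by ring
    rw [hZ] at c2 c3 hZ0
    have Bh' : L (h ^ 8) ≤ (7 ^ (l + 1) * L (h ^ 2)) ^ 4 := Bh.trans_eq (by ring)
    have Bg' : L (g ^ 8) ≤ (7 ^ l * L (g ^ 2)) ^ 4 := Bg.trans_eq (by ring)
    have key := two_point_bound (mul_nonneg (pow_nonneg (by norm_num) _) h2)
      (mul_nonneg (pow_nonneg (by norm_num) _) g2) Bh' Bg' (p8 g) hZ0 c1 c2 c3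
    generalize L (h ^ 2) = a at *
    generalize L (g ^ 2) = b at *
    have e : (7 ^ (l + 1) * a + 7 * (7 ^ l * b)) ^ 4 = 7 ^ (4 * (l + 1)) * (a + b) ^ 4 := by
      ring
    rwa [← e]

lemma IsHypercontractive.of_tendsto {L : ℕ → MvPolynomial σ ℝ →ₗ[ℝ] ℝ}
    {L' : MvPolynomial σ ℝ →ₗ[ℝ] ℝ} (hL : ∀ n, IsHypercontractive (L n))
    (h : ∀ p, Filter.Tendsto (fun n => L n p) Filter.atTop (nhds (L' p))) :
    IsHypercontractive L' :=
  ⟨fun p => ge_of_tendsto' (h _) fun n => (hL n).sq_nonneg p, fun l p hp =>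
    le_of_tendsto_of_tendsto' (h _) (((h _).pow 4).const_mul _) fun n => (hL n).le_pow l p hp⟩

end MvPolynomial

/-! ### Random walk moments and their Gaussian limit -/

/-- Expectation of `f` at the endpoint of the simple symmetric random walk on `ℝ` started at `0`,
with `n` steps of size `a`. -/
noncomputable def walkMean (a : ℝ) : ℕ → (ℝ → ℝ) → ℝ
  | 0, f => f 0
  | n + 1, f => walkMean a n fun t => (1 / 2) * (f (t + a) + f (t - a))

lemma walkMean_smul (a : ℝ) (n : ℕ) (c : ℝ) (f : ℝ → ℝ) :
    walkMean a n (fun t => c * f t) = c * walkMean a n f := by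
  induction n generalizing f with
  | zero => rfl
  | succ n ih =>
    rw [walkMean, walkMean, ← ih]
    congr 1; ext t; ring

lemma walkMean_add (a : ℝ) (n : ℕ) (f g : ℝ → ℝ) :
    walkMean a n (fun t => f t + g t) = walkMean a n f + walkMean a n g := by
  induction n generalizing f g with
  | zero => rfl
  | succ n ih =>
    rw [walkMean, walkMean, walkMean, ← ih]
    congr 1; ext t; ring

lemma walkMean_sum {ι : Type*} (a : ℝ) (n : ℕ) (s : Finset ι) (f : ι → ℝ → ℝ) :
    walkMean a n (fun t => ∑ i ∈ s, f i t) = ∑ i ∈ s, walkMean a n (f i) := by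
  classical
  induction s using Finset.induction_on with
  | empty => simpa using walkMean_smul a n 0 fun _ => 0
  | insert i s hi ih => simp only [Finset.sum_insert hi, walkMean_add, ih]

/-- The moments of the endpoint of the random walk. -/
noncomputable def walkMoment (a : ℝ) (n k : ℕ) : ℝ := walkMean a n fun t => t ^ k

lemma walkMoment_zero_left (a : ℝ) (k : ℕ) : walkMoment a 0 k = 0 ^ k := rfl

lemma walkMoment_zero_right (a : ℝ) (n : ℕ) : walkMoment a n 0 = 1 := by
  induction n with
  | zero => simp [walkMoment_zero_left]
  | succ n ih => rw [← ih]; simp [walkMoment, walkMean]; norm_num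

/-- The moments of the sum of a random variable with moments `m` and an independent symmetric sign
times `a`. -/
noncomputable def momentStep (a : ℝ) (m : ℕ → ℝ) (k : ℕ) : ℝ :=
  ∑ j ∈ Finset.range (k + 1), (1 / 2) * (a ^ (k - j) + (-a) ^ (k - j)) * k.choose j * m j

lemma walkMoment_succ (a : ℝ) (n : ℕ) :
    walkMoment a (n + 1) = momentStep a (walkMoment a n) := by
  ext k
  simp only [momentStep, walkMoment, walkMean, ← walkMean_smul]
  rw [← walkMean_sum]
  congr 1
  ext t
  rw [sub_eq_add_neg, add_pow, add_pow, ← Finset.sum_add_distrib, Finset.mul_sum]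
  exact Finset.sum_congr rfl fun j _ => by ring

/-- A discrete Stein identity: by exchangeability each of the `n + 1` steps contributes equally to
the factor `t`, and one step is averaged explicitly. -/
lemma walkMean_succ_id_mul (a : ℝ) (n : ℕ) (f : ℝ → ℝ) :
    walkMean a (n + 1) (fun t => t * f t) =
      (n + 1) * a * walkMean a n fun t => (1 / 2) * (f (t + a) - f (t - a)) := by
  induction n generalizing f with
  | zero => simp only [walkMean]; push_cast; ring
  | succ n ih =>
    have h : walkMean a (n + 1 + 1) (fun t => t * f t) =
        walkMean a (n + 1) (fun t => t * ((1 / 2) * (f (t + a) + f (t - a)))) +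
          a * walkMean a (n + 1) fun t => (1 / 2) * (f (t + a) - f (t - a)) := by
      rw [← walkMean_smul, ← walkMean_add, walkMean]
      congr 1; ext t; ring
    rw [h, ih, walkMean]
    push_cast
    rw [show (n + 1 + 1 : ℝ) * a = (n + 1) * a + a by ring, add_mul ((n + 1) * a)]
    congr 3
    ext t
    ring_nf

lemma walkMoment_succ_succ (a : ℝ) (n k : ℕ) :
    walkMoment a (n + 1) (k + 1) = ((n + 1) * a ^ 2) * ∑ j ∈ Finset.range k,
      (1 / 2) * (a ^ (k - 1 - j) + (-a) ^ (k - 1 - j)) * k.choose j * walkMoment a n j := by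
  have h : walkMoment a (n + 1) (k + 1) = walkMean a (n + 1) fun t => t * t ^ k := by
    simp only [walkMoment, pow_succ']
  rw [h, walkMean_succ_id_mul, show (n + 1 : ℝ) * a ^ 2 = (n + 1) * a * a by ring,
    mul_assoc ((n + 1 : ℝ) * a) a]
  congr 1
  simp only [walkMoment, ← walkMean_smul]
  rw [← walkMean_sum, ← walkMean_smul]
  congr 1
  ext t
  -- The `t ^ k` terms cancel, so every remaining term carries a factor `a`, which completes the
  -- variance `(n + 1) * a ^ 2`.
  rw [sub_eq_add_neg t a, add_pow, add_pow, Finset.sum_range_succ, Finset.sum_range_succ,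
    Nat.sub_self, pow_zero, pow_zero, add_sub_add_right_eq_sub, ← Finset.sum_sub_distrib,
    Finset.mul_sum, Finset.mul_sum]
  refine Finset.sum_congr rfl fun j hj => ?_
  obtain ⟨r, rfl⟩ : ∃ r, k = j + r + 1 := ⟨k - j - 1, by have := Finset.mem_range.1 hj; omega⟩
  rw [show j + r + 1 - j = r + 1 by omega, show j + r + 1 - 1 - j = r by omega]
  ring

/-- The walk's moment recursion degenerates to the Gaussian one as the step size tends to `0`. It
also lowers the number of steps by one, so the induction must allow any `n` of limiting variance
`1`. -/
lemma tendsto_walkMoment {γ : ℕ → ℝ} (h0 : γ 0 = 1) (h1 : γ 1 = 0)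
    (h2 : ∀ k, γ (k + 2) = (k + 1) * γ k) {a : ℕ → ℝ} {n : ℕ → ℕ}
    (ha : Filter.Tendsto a Filter.atTop (nhds 0))
    (hn : Filter.Tendsto (fun i => (n i + 1 : ℝ) * a i ^ 2) Filter.atTop (nhds 1)) (k : ℕ) :
    Filter.Tendsto (fun i => walkMoment (a i) (n i + 1) k) Filter.atTop (nhds (γ k)) := by
  induction k using Nat.strong_induction_on generalizing n with
  | _ k ih =>
    match k, ih with
    | 0, _ => simp [walkMoment_zero_right, h0]
    | 1, _ => simp [walkMoment_succ_succ, h1]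
    | k + 2, ih =>
      have ha2 : Filter.Tendsto (fun i => a i ^ 2) Filter.atTop (nhds 0) := by
        simpa using ha.pow 2
      have hn' : Filter.Tendsto (fun i => (n i : ℝ) * a i ^ 2) Filter.atTop (nhds 1) := by
        simpa [add_mul] using hn.sub ha2
      have hpos : ∀ᶠ i in Filter.atTop, n i ≠ 0 := by
        filter_upwards [hn'.eventually_ne one_ne_zero] with i hi h
        simp [h] at hi
      have hn'' : Filter.Tendsto (fun i => ((n i - 1 : ℕ) + 1 : ℝ) * a i ^ 2)
          Filter.atTop (nhds 1) := by
        refine hn'.congr' ?_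
        filter_upwards [hpos] with i hi
        rw [Nat.cast_pred (Nat.pos_of_ne_zero hi), sub_add_cancel]
      have hm : ∀ j < k + 2, Filter.Tendsto (fun i => walkMoment (a i) (n i) j) Filter.atTop
          (nhds (γ j)) := fun j hj => by
        refine (ih j hj hn'').congr' ?_
        filter_upwards [hpos] with i hi
        rw [Nat.sub_add_cancel (Nat.pos_of_ne_zero hi)]
      simp only [walkMoment_succ_succ]
      -- Only `j = k` survives at step size `0`, with coefficient `(k + 1).choose k`.
      have hγ : γ (k + 2) = 1 * ∑ j ∈ Finset.range (k + 1),
          (1 / 2) * (0 ^ (k - j) + (-0) ^ (k - j)) * (k + 1).choose j * γ j := by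
        rw [Finset.sum_range_succ, Finset.sum_eq_zero, h2]
        · simp; norm_num
        · intro j hj
          have : k - j ≠ 0 := by have := Finset.mem_range.1 hj; omega
          simp [this]
      rw [hγ]
      refine hn.mul (tendsto_finsetSum _ fun j hj => ?_)
      refine Filter.Tendsto.mul (Filter.Tendsto.mul_const _ ?_)
        (hm j ((Finset.mem_range.1 hj).trans (Nat.lt_succ_self _)))
      exact ((ha.pow _).add (ha.neg.pow _)).const_mul _

/-! ### Product moment functionals and Gaussian hypercontractivity -/

namespace MvPolynomial

variable {σ : Type*}

section Fintype

variable [Fintype σ]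

/-- The linear functional sending the monomial `∏ X i ^ d i` to `∏ M i (d i)`: the expectation of a
polynomial in independent variables whose moments are given by `M`. -/
noncomputable def momentFunctional (M : σ → ℕ → ℝ) : MvPolynomial σ ℝ →ₗ[ℝ] ℝ :=
  (basisMonomials σ ℝ).constr ℝ fun d => ∏ i, M i (d i)

lemma momentFunctional_monomial (M : σ → ℕ → ℝ) (d : σ →₀ ℕ) (c : ℝ) :
    momentFunctional M (monomial d c) = c * ∏ i, M i (d i) := by
  have h : monomial d c = c • basisMonomials σ ℝ d := by
    simp [smul_monomial]
  rw [h, map_smul, momentFunctional, Module.Basis.constr_basis, smul_eq_mul]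

lemma momentFunctional_eq_sum (M : σ → ℕ → ℝ) (p : MvPolynomial σ ℝ) :
    momentFunctional M p = ∑ d ∈ p.support, coeff d p * ∏ i, M i (d i) := by
  conv_lhs => rw [p.as_sum, map_sum]
  simp only [momentFunctional_monomial]

lemma tendsto_momentFunctional {M : ℕ → σ → ℕ → ℝ} {M' : σ → ℕ → ℝ}
    (h : ∀ i k, Filter.Tendsto (fun n => M n i k) Filter.atTop (nhds (M' i k)))
    (p : MvPolynomial σ ℝ) :
    Filter.Tendsto (fun n => momentFunctional (M n) p) Filter.atTop
      (nhds (momentFunctional M' p)) := by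
  simp only [momentFunctional_eq_sum]
  exact tendsto_finsetSum _ fun d _ => (tendsto_finsetProd _ fun i _ => h i _).const_mul _

lemma isHypercontractive_momentFunctional_zero :
    IsHypercontractive (momentFunctional fun (_ : σ) k => (0 : ℝ) ^ k) := by
  have h : momentFunctional (fun (_ : σ) k => (0 : ℝ) ^ k) = (aeval (0 : σ → ℝ)).toLinearMap := by
    classical
    refine (basisMonomials σ ℝ).ext fun d => ?_
    rw [coe_basisMonomials]
    simp [momentFunctional_monomial, aeval_monomial, Finsupp.prod_fintype]
  rw [h]
  refine ⟨fun p => ?_, fun l p _ => ?_⟩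
  · simp only [AlgHom.toLinearMap_apply, map_pow]; positivity
  · simp only [AlgHom.toLinearMap_apply, map_pow, ← pow_mul, Nat.reduceMul]
    exact le_mul_of_one_le_left (by positivity) (one_le_pow₀ (by norm_num))

end Fintype

variable [DecidableEq σ]

lemma translate_single_monomial (i : σ) (a : ℝ) (d : σ →₀ ℕ) :
    translate (Pi.single i a) (monomial d 1) = ∑ j ∈ Finset.range (d i + 1),
      monomial (d.erase i + Finsupp.single i j) (a ^ (d i - j) * (d i).choose j) := by
  have h : (monomial d 1 : MvPolynomial σ ℝ) = monomial (d.erase i) 1 * X i ^ d i := by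
    rw [← monomial_add_single, add_comm, Finsupp.single_add_erase]
  have h1 : translate (Pi.single i a) (monomial (d.erase i) (1 : ℝ)) = monomial (d.erase i) 1 := by
    rw [translate, aeval_monomial, map_one, one_mul, monomial_eq, map_one, one_mul]
    refine Finsupp.prod_congr fun j hj => ?_
    have : j ≠ i := by rintro rfl; simp at hj
    simp [this]
  rw [h, map_mul, h1, map_pow, show translate (Pi.single i a) (X i) = X i + C a by
    simp [translate], add_pow, Finset.mul_sum]
  refine Finset.sum_congr rfl fun j _ => ?_
  rw [← mul_one (a ^ (d i - j) * ((d i).choose j : ℝ)), ← C_mul_monomial, monomial_add_single]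
  simp
  ring

variable [Fintype σ]

/-- Translating along one axis only expands the power of `X i`, so product functionals stay product
functionals. -/
lemma symmetrize_momentFunctional (M : σ → ℕ → ℝ) (i : σ) (a : ℝ) :
    symmetrize (Pi.single i a) (momentFunctional M) =
      momentFunctional (Function.update M i (momentStep a (M i))) := by
  refine (basisMonomials σ ℝ).ext fun d => ?_
  have hp : ∀ m : ℕ → ℝ, ∀ e : σ →₀ ℕ, ∏ j, Function.update M i m j (e j) =
      m (e i) * ∏ j ∈ Finset.univ.erase i, M j (e j) := fun m e => by
    rw [← Finset.mul_prod_erase _ _ (Finset.mem_univ i), Function.update_self]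
    congr 1
    exact Finset.prod_congr rfl fun j hj => by
      rw [Function.update_of_ne (Finset.ne_of_mem_erase hj)]
  have hp' : ∀ e : σ →₀ ℕ, ∏ j, M j (e j) = M i (e i) * ∏ j ∈ Finset.univ.erase i, M j (e j) :=
    fun e => (Finset.mul_prod_erase _ _ (Finset.mem_univ i)).symm
  have he : ∀ n, ∏ j ∈ Finset.univ.erase i, M j ((d.erase i + Finsupp.single i n : σ →₀ ℕ) j) =
      ∏ j ∈ Finset.univ.erase i, M j (d j) := fun n => Finset.prod_congr rfl fun j hj => by
    have := Finset.ne_of_mem_erase hj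
    simp [this]
  rw [coe_basisMonomials]
  simp only [symmetrize, LinearMap.smul_apply, LinearMap.add_apply, LinearMap.comp_apply,
    AlgHom.toLinearMap_apply, smul_eq_mul, ← Pi.single_neg, translate_single_monomial, map_sum,
    momentFunctional_monomial, hp]
  simp only [hp', he]
  rw [← Finset.sum_add_distrib, Finset.mul_sum, momentStep, one_mul, Finset.sum_mul]
  refine Finset.sum_congr rfl fun j _ => ?_
  simp
  ring

lemma IsHypercontractive.update_walkMoment {M : σ → ℕ → ℝ} {i : σ} (hi : ∀ k, M i k = 0 ^ k)
    (h : IsHypercontractive (momentFunctional M)) (a : ℝ) (n : ℕ) :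
    IsHypercontractive (momentFunctional (Function.update M i (walkMoment a n))) := by
  induction n with
  | zero =>
    have hw : walkMoment a 0 = M i := by
      ext k
      rw [hi, walkMoment_zero_left]
    rwa [hw, Function.update_eq_self]
  | succ n ih =>
    have := ih.symmetrize (Pi.single i a)
    rwa [symmetrize_momentFunctional, Function.update_self, Function.update_idem,
      ← walkMoment_succ] at this

lemma isHypercontractive_momentFunctional {γ : ℕ → ℝ} (h0 : γ 0 = 1) (h1 : γ 1 = 0)
    (h2 : ∀ k, γ (k + 2) = (k + 1) * γ k) :
    IsHypercontractive (momentFunctional fun (_ : σ) => γ) := by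
  -- Coordinates in `s` are already Gaussian, the others still sit at the origin.
  suffices H : ∀ s : Finset σ, IsHypercontractive
      (momentFunctional fun i => if i ∈ s then γ else fun k => 0 ^ k) by
    simpa using H Finset.univ
  intro s
  induction s using Finset.induction_on with
  | empty => simpa using isHypercontractive_momentFunctional_zero
  | insert i s hi ih =>
    have hn : Filter.Tendsto (fun n : ℕ => (n + 1 : ℝ)⁻¹) Filter.atTop (nhds 0) := by
      simpa using tendsto_one_div_add_atTop_nhds_zero_nat (𝕜 := ℝ)
    have ha : Filter.Tendsto (fun n : ℕ => √((n + 1 : ℝ)⁻¹)) Filter.atTop (nhds 0) := by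
      simpa using hn.sqrt
    have key := tendsto_walkMoment h0 h1 h2 ha (n := id) (by
      refine tendsto_const_nhds.congr fun n => ?_
      have : (0 : ℝ) < n + 1 := by positivity
      rw [Real.sq_sqrt (by positivity), id, mul_inv_cancel₀ this.ne'])
    refine IsHypercontractive.of_tendsto (fun n => ih.update_walkMoment (i := i)
      (fun k => by simp [hi]) (√((n + 1 : ℝ)⁻¹)) (n + 1)) (tendsto_momentFunctional fun j k => ?_)
    by_cases hj : j = i
    · subst hj
      simpa using key k
    · simp [hj]

end MvPolynomial

/-! ### Moments of Gaussian measures -/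

/-- Differentiate `M' = t M` repeatedly, where `M` is the standard Gaussian moment generating
function; at `t = 0` this is the moment recursion. -/
lemma iteratedDeriv_exp_sq_half (n : ℕ) :
    iteratedDeriv (n + 2) (fun t : ℝ => Real.exp (t ^ 2 / 2)) = fun t =>
      t * iteratedDeriv (n + 1) (fun t : ℝ => Real.exp (t ^ 2 / 2)) t +
        (n + 1) * iteratedDeriv n (fun t : ℝ => Real.exp (t ^ 2 / 2)) t := by
  set M : ℝ → ℝ := fun t => Real.exp (t ^ 2 / 2) with hM
  have hd : ∀ n t, HasDerivAt (iteratedDeriv n M) (iteratedDeriv (n + 1) M t) t := fun n t => by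
    have hc : ContDiff ℝ (n + 1 : ℕ) M := by fun_prop
    rw [iteratedDeriv_succ]
    exact (hc.differentiable_iteratedDeriv n (by norm_cast; omega) t).hasDerivAt
  have h1 : iteratedDeriv 1 M = fun t => t * M t := by
    ext t
    rw [iteratedDeriv_one, hM]
    have : HasDerivAt (fun t : ℝ => Real.exp (t ^ 2 / 2)) (Real.exp (t ^ 2 / 2) * t) t := by
      simpa using (((hasDerivAt_pow 2 t).div_const 2).exp)
    rw [this.deriv, mul_comm]
  induction n with
  | zero =>
    ext t
    have h0 := hd 0 t
    rw [iteratedDeriv_zero] at h0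
    rw [zero_add, iteratedDeriv_succ]
    conv_lhs => rw [h1]
    have h : HasDerivAt (fun t => t * M t) _ t := (hasDerivAt_id' t).mul h0
    rw [h.deriv, iteratedDeriv_zero]
    push_cast
    ring
  | succ n ih =>
    ext t
    have h : HasDerivAt (fun t => t * iteratedDeriv (n + 1) M t + (n + 1) * iteratedDeriv n M t)
        _ t := ((hasDerivAt_id' t).mul (hd (n + 1) t)).add ((hd n t).const_mul _)
    rw [← ih] at h
    rw [show n + 1 + 2 = n + 2 + 1 from rfl, iteratedDeriv_succ, h.deriv]
    push_cast
    ring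

lemma integral_pow_gaussianReal (n : ℕ) :
    ∫ t, t ^ n ∂gaussianReal 0 1 = iteratedDeriv n (fun t : ℝ => Real.exp (t ^ 2 / 2)) 0 := by
  have h := iteratedDeriv_mgf_zero (X := id) (μ := gaussianReal 0 1)
    (by rw [integrableExpSet_id_gaussianReal]; simp) n
  rw [mgf_id_gaussianReal] at h
  simpa using h.symm

lemma integral_pow_add_two_gaussianReal (n : ℕ) :
    ∫ t, t ^ (n + 2) ∂gaussianReal 0 1 = (n + 1) * ∫ t, t ^ n ∂gaussianReal 0 1 := by
  rw [integral_pow_gaussianReal, integral_pow_gaussianReal, iteratedDeriv_exp_sq_half]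
  ring

lemma integrable_pow_gaussianReal (n : ℕ) : Integrable (fun t => t ^ n) (gaussianReal 0 1) := by
  have h := (memLp_id_gaussianReal' (μ := 0) (v := 1) n (by simp)).integrable_norm_pow'
  refine (integrable_norm_iff (by fun_prop)).1 ?_
  simpa using h

namespace MvPolynomial

variable {σ : Type*} [Fintype σ]

lemma integrable_eval_pi_gaussianReal (p : MvPolynomial σ ℝ) :
    Integrable (fun z => eval z p) (Measure.pi fun _ : σ => gaussianReal 0 1) := by
  simp only [eval_eq']
  exact integrable_finsetSum _ fun d _ =>
    (Integrable.fintype_prod fun i => integrable_pow_gaussianReal (d i)).const_mul _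

lemma integral_eval_pi_gaussianReal (p : MvPolynomial σ ℝ) :
    ∫ z, eval z p ∂(Measure.pi fun _ : σ => gaussianReal 0 1) =
      momentFunctional (fun _ k => ∫ t, t ^ k ∂gaussianReal 0 1) p := by
  simp only [eval_eq']
  rw [integral_finsetSum, momentFunctional_eq_sum]
  · refine Finset.sum_congr rfl fun d _ => ?_
    rw [integral_const_mul, integral_fintype_prod_eq_prod (f := fun i t => t ^ d i)]
  · exact fun d _ =>
      (Integrable.fintype_prod fun i => integrable_pow_gaussianReal (d i)).const_mul _

/-- Gaussian hypercontractivity: the `L²`-`L⁸` inequality for polynomials of degree at most `l` in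
independent standard Gaussian variables. -/
lemma integral_eval_pow_eight_pi_gaussianReal_le {l : ℕ} {p : MvPolynomial σ ℝ}
    (hp : p.totalDegree ≤ l) :
    ∫ z, eval z p ^ 8 ∂(Measure.pi fun _ : σ => gaussianReal 0 1) ≤
      7 ^ (4 * l) * (∫ z, eval z p ^ 2 ∂(Measure.pi fun _ : σ => gaussianReal 0 1)) ^ 4 := by
  classical
  simp only [← map_pow, integral_eval_pi_gaussianReal]
  exact (isHypercontractive_momentFunctional (by simp) (by simp)
    integral_pow_add_two_gaussianReal).le_pow l p hp

end MvPolynomial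

section

variable {Ω : Type*} [MeasurableSpace Ω] {P : Measure Ω} {d : ℕ}
  {S : Matrix (Fin d) (Fin d) ℝ} {x : Ω → EuclideanSpace ℝ (Fin d)}

lemma MvPolynomial.measurable_eval_ofLp (p : MvPolynomial (Fin d) ℝ) :
    Measurable fun v : EuclideanSpace ℝ (Fin d) => eval v.ofLp p :=
  (MvPolynomial.continuous_eval p).measurable.comp (by fun_prop)

/-- The Gaussian vector is `S^{1/2} z` with `z` standard, and substituting linear forms does not
raise the degree. -/
lemma exists_hasLaw_eval_multivariateGaussian (S : Matrix (Fin d) (Fin d) ℝ)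
    {p : MvPolynomial (Fin d) ℝ} {l : ℕ} (hp : p.totalDegree ≤ l) :
    ∃ q : MvPolynomial (Fin d) ℝ, q.totalDegree ≤ l ∧
      (multivariateGaussian 0 S).map (fun v => MvPolynomial.eval v.ofLp p) =
        (Measure.pi fun _ : Fin d => gaussianReal 0 1).map (fun z => MvPolynomial.eval z q) := by
  refine ⟨MvPolynomial.aeval (fun i => ∑ j, MvPolynomial.C (CFC.sqrt S i j) * MvPolynomial.X j) p,
    MvPolynomial.totalDegree_aeval_le hp fun i => MvPolynomial.totalDegree_finsetSum_le fun j _ =>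
      (MvPolynomial.totalDegree_mul _ _).trans (by simp), ?_⟩
  have hm := MvPolynomial.measurable_eval_ofLp p
  rw [multivariateGaussian, ← map_pi_eq_stdGaussian, Measure.map_map hm (by fun_prop),
    Measure.map_map (hm.comp (by fun_prop)) (by fun_prop)]
  congr 1
  ext z
  simp only [Function.comp_apply, ← MvPolynomial.coe_aeval_eq_eval, RingHom.coe_coe, zero_add, Matrix.toEuclideanCLM_toLp,
    ← AlgHom.comp_apply, MvPolynomial.comp_aeval]
  congr 2
  ext i
  simp [Matrix.mulVec, dotProduct]

lemma integrable_eval_of_hasLaw (hx : HasLaw x (multivariateGaussian 0 S) P)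
    (p : MvPolynomial (Fin d) ℝ) :
    Integrable (fun ω => MvPolynomial.eval (x ω).ofLp p) P := by
  obtain ⟨q, -, hq⟩ := exists_hasLaw_eval_multivariateGaussian S (p := p) le_rfl
  have hm := MvPolynomial.measurable_eval_ofLp p
  have h := MvPolynomial.integrable_eval_pi_gaussianReal q
  have h' : Integrable id ((multivariateGaussian 0 S).map
      (fun v => MvPolynomial.eval v.ofLp p)) := by
    rw [hq]
    exact (integrable_map_measure (by fun_prop)
      (MvPolynomial.continuous_eval q).aemeasurable).2 h
  rw [integrable_map_measure (by fun_prop) hm.aemeasurable, ← hx.map_eq,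
    Function.id_comp,
    integrable_map_measure hm.aestronglyMeasurable hx.aemeasurable] at h'
  exact h'

lemma integral_eval_pow_eight_le_of_hasLaw (hx : HasLaw x (multivariateGaussian 0 S) P)
    {p : MvPolynomial (Fin d) ℝ} {l : ℕ} (hp : p.totalDegree ≤ l) :
    ∫ ω, MvPolynomial.eval (x ω).ofLp p ^ 8 ∂P ≤
      7 ^ (4 * l) * (∫ ω, MvPolynomial.eval (x ω).ofLp p ^ 2 ∂P) ^ 4 := by
  obtain ⟨q, hql, hq⟩ := exists_hasLaw_eval_multivariateGaussian S hp
  have hm := MvPolynomial.measurable_eval_ofLp p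
  have h : ∀ n : ℕ, ∫ ω, MvPolynomial.eval (x ω).ofLp p ^ n ∂P =
      ∫ z, MvPolynomial.eval z q ^ n ∂(Measure.pi fun _ : Fin d => gaussianReal 0 1) := fun n => by
    have h1 := hx.integral_comp (f := fun v => MvPolynomial.eval v.ofLp p ^ n)
      (hm.pow_const n).aestronglyMeasurable
    rw [Function.comp_def] at h1
    rw [h1, ← integral_map (f := fun t : ℝ => t ^ n) hm.aemeasurable (by fun_prop), hq,
      integral_map (MvPolynomial.continuous_eval q).aemeasurable (by fun_prop)]
  rw [h, h]
  exact MvPolynomial.integral_eval_pow_eight_pi_gaussianReal_le hql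

end

/-! ### Eighth moments and independent noise -/

section

variable {Ω : Type*} [MeasurableSpace Ω] {P : Measure Ω}

lemma memLp_eight_of_integrable {f : Ω → ℝ} (hf : AEStronglyMeasurable f P)
    (h : Integrable (fun ω => f ω ^ 8) P) : MemLp f 8 P := by
  refine (integrable_norm_rpow_iff hf (by norm_num) (by norm_num)).1 ?_
  refine h.congr (.of_forall fun ω => ?_)
  have : (8 : ENNReal).toReal = ((8 : ℕ) : ℝ) := by norm_num
  simp only [this, Real.rpow_natCast, Real.norm_eq_abs]
  exact (Even.pow_abs (by decide) _).symm

lemma lpNorm_eight_eq {f : Ω → ℝ} (hf : AEStronglyMeasurable f P) :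
    lpNorm f 8 P = (∫ ω, f ω ^ 8 ∂P) ^ (1 / 8 : ℝ) := by
  rw [lpNorm_eq_integral_norm_rpow_toReal (by norm_num) (by norm_num) hf]
  have : (8 : ENNReal).toReal = ((8 : ℕ) : ℝ) := by norm_num
  simp only [this, Real.rpow_natCast, Real.norm_eq_abs]
  congr 1
  · exact integral_congr_ae (.of_forall fun ω => Even.pow_abs (by decide) _)
  · norm_num

lemma integral_sq_pow_four_le [IsProbabilityMeasure P] {f : Ω → ℝ} (hf : AEStronglyMeasurable f P)
    (h : Integrable (fun ω => f ω ^ 8) P) :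
    (∫ ω, f ω ^ 2 ∂P) ^ 4 ≤ ∫ ω, f ω ^ 8 ∂P := by
  have h2 : Integrable (fun ω => f ω ^ 2) P :=
    ((memLp_eight_of_integrable hf h).mono_exponent (by norm_num)).integrable_sq
  have := (Even.convexOn_pow (by decide : Even 4)).map_integral_le (μ := P)
    (f := fun ω => f ω ^ 2) (g := fun t : ℝ => t ^ 4) (by fun_prop) isClosed_univ (by simp) h2
    (by simpa [Function.comp_def, ← pow_mul] using h)
  simpa [← pow_mul] using this

end

lemma rpow_one_eighth_le_of_le {I A : ℝ} {l : ℕ} (hI : 0 ≤ I) (hA : 0 ≤ A)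
    (h : I ≤ 7 ^ (4 * l) * A ^ 4) : I ^ (1 / 8 : ℝ) ≤ √7 ^ l * √A := by
  have e : 7 ^ (4 * l) * A ^ 4 = (√7 ^ l * √A) ^ 8 := by
    rw [mul_pow, ← pow_mul, show l * 8 = 2 * (4 * l) by ring, pow_mul √7,
      Real.sq_sqrt (by norm_num : (0 : ℝ) ≤ 7), show √A ^ 8 = (√A ^ 2) ^ 4 by ring, Real.sq_sqrt hA]
  have := Real.rpow_le_rpow hI (h.trans_eq e) (by norm_num : (0 : ℝ) ≤ 1 / 8)
  rwa [show (√7 ^ l * √A) ^ 8 = (√7 ^ l * √A) ^ ((8 : ℕ) : ℝ) from (Real.rpow_natCast _ _).symm,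
    ← Real.rpow_mul (by positivity), show ((8 : ℕ) : ℝ) * (1 / 8) = 1 by norm_num,
    Real.rpow_one] at this

/-- Here `A`, `C`, `x₂` stand for the second moments of `u`, `c`, `ξ`, and `x₈` for the L⁸ norm of
`ξ`. -/
lemma div_rpow_half_le {N A C x₂ x₈ K : ℝ} (hA : 0 ≤ A) (hC : 0 ≤ C) (hK : 0 ≤ K) (h2 : 0 < x₂)
    (h28 : √x₂ ≤ x₈) (hN : N ≤ K * √A + K * √C * x₈) :
    N / (A + C * x₂) ^ (1 / 2 : ℝ) ≤ √2 * K * (x₈ / x₂ ^ (1 / 2 : ℝ)) := by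
  rw [← Real.sqrt_eq_rpow, ← Real.sqrt_eq_rpow]
  have hs : 0 < √x₂ := Real.sqrt_pos.2 h2
  have h8 : 0 < x₈ := hs.trans_le h28
  have hT : 0 ≤ A + C * x₂ := by positivity
  rcases hT.eq_or_lt with h0 | hpos
  -- A vanishing residual: the quotient is `0` by the convention for division by zero.
  · rw [← h0, Real.sqrt_zero, div_zero]
    positivity
  have hR : 0 < √(A + C * x₂) := Real.sqrt_pos.2 hpos
  rw [← mul_div_assoc, div_le_div_iff₀ hR hs]
  have hsum : √A + √C * √x₂ ≤ √2 * √(A + C * x₂) := by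
    rw [← Real.sqrt_mul (by norm_num : (0 : ℝ) ≤ 2)]
    refine Real.le_sqrt_of_sq_le ?_
    have e : (√C * √x₂) ^ 2 = C * x₂ := by rw [mul_pow, Real.sq_sqrt hC, Real.sq_sqrt h2.le]
    have eA := Real.sq_sqrt hA
    nlinarith [sq_nonneg (√A - √C * √x₂)]
  calc N * √x₂ ≤ (K * √A + K * √C * x₈) * √x₂ := by gcongr
    _ = K * (√A * √x₂ + x₈ * (√C * √x₂)) := by ring
    _ ≤ K * (√A * x₈ + x₈ * (√C * √x₂)) := by gcongr
    _ = K * x₈ * (√A + √C * √x₂) := by ring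
    _ ≤ K * x₈ * (√2 * √(A + C * x₂)) := by gcongr
    _ = _ := by ring

section

variable {Ω : Type*} [MeasurableSpace Ω] {P : Measure Ω}

lemma integral_pow_eight_nonneg (f : Ω → ℝ) : 0 ≤ ∫ ω, f ω ^ 8 ∂P :=
  integral_nonneg fun _ => Even.pow_nonneg (by decide) _

lemma integral_sq_nonneg (f : Ω → ℝ) : 0 ≤ ∫ ω, f ω ^ 2 ∂P :=
  integral_nonneg fun _ => sq_nonneg _

/-- If `u` and `c` satisfy the hypercontractive `L²`-`L⁸` inequality with constant `√7 ^ l` and `ξ`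
is a centered noise independent of `(u, c)`, then `u - c ξ` satisfies such an inequality. -/
lemma memLp_and_ratio_le_of_indepFun [IsProbabilityMeasure P] {u c ξ : Ω → ℝ} {l : ℕ} (hu : MemLp u 8 P)
    (hc : MemLp c 8 P) (hξm : AEMeasurable ξ P) (hind : IndepFun (fun ω => (u ω, c ω)) ξ P)
    (hξ8 : Integrable (fun ω => ξ ω ^ 8) P) (hξmean : ∫ ω, ξ ω ∂P = 0)
    (hξ2 : 0 < ∫ ω, ξ ω ^ 2 ∂P)
    (hul : ∫ ω, u ω ^ 8 ∂P ≤ 7 ^ (4 * l) * (∫ ω, u ω ^ 2 ∂P) ^ 4)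
    (hcl : ∫ ω, c ω ^ 8 ∂P ≤ 7 ^ (4 * l) * (∫ ω, c ω ^ 2 ∂P) ^ 4) :
    MemLp (fun ω => u ω - c ω * ξ ω) 8 P ∧
      (∫ ω, (u ω - c ω * ξ ω) ^ 8 ∂P) ^ (1 / 8 : ℝ) /
        (∫ ω, (u ω - c ω * ξ ω) ^ 2 ∂P) ^ (1 / 2 : ℝ) ≤
        √2 * √7 ^ l *
          ((∫ ω, ξ ω ^ 8 ∂P) ^ (1 / 8 : ℝ) / (∫ ω, ξ ω ^ 2 ∂P) ^ (1 / 2 : ℝ)) := by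
  have hξs := hξm.aestronglyMeasurable
  have hξ : MemLp ξ 8 P := memLp_eight_of_integrable hξs hξ8
  have hξ1 : Integrable ξ P := hξ.integrable (by norm_num)
  have hu2 : MemLp u 2 P := hu.mono_exponent (by norm_num)
  have hc2 : MemLp c 2 P := hc.mono_exponent (by norm_num)
  have hξsq : Integrable (fun ω => ξ ω ^ 2) P := (hξ.mono_exponent (by norm_num)).integrable_sq
  have huc : Integrable (fun ω => u ω * c ω) P := hu2.integrable_mul hc2
  have hc8 : Integrable (fun ω => c ω ^ 8) P := by
    have h := hc.integrable_norm_pow (p := 8) (by norm_num)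
    refine h.congr (.of_forall fun ω => ?_)
    simp only [Real.norm_eq_abs]
    exact Even.pow_abs (by decide) _
  have hi1 : IndepFun (fun ω => u ω * c ω) ξ P :=
    hind.comp (φ := fun z : ℝ × ℝ => z.1 * z.2) (ψ := id) (by fun_prop) measurable_id
  have hi : ∀ n : ℕ, IndepFun (fun ω => c ω ^ n) (fun ω => ξ ω ^ n) P := fun n =>
    hind.comp (φ := fun z : ℝ × ℝ => z.2 ^ n) (ψ := fun t : ℝ => t ^ n) (by fun_prop)
      (by fun_prop)
  -- Independence keeps the product in L⁸ without moments beyond the eighth.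
  have hcξ8 : Integrable (fun ω => c ω ^ 8 * ξ ω ^ 8) P := (hi 8).integrable_mul hc8 hξ8
  have hcξ2 : Integrable (fun ω => c ω ^ 2 * ξ ω ^ 2) P :=
    (hi 2).integrable_mul hc2.integrable_sq hξsq
  have hucξ : Integrable (fun ω => u ω * c ω * ξ ω) P := hi1.integrable_mul huc hξ1
  have hV : MemLp (fun ω => c ω * ξ ω) 8 P :=
    memLp_eight_of_integrable (hc.aestronglyMeasurable.mul hξs) (by simpa only [mul_pow] using hcξ8)
  have hUV : MemLp (fun ω => u ω - c ω * ξ ω) 8 P := hu.sub hV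
  refine ⟨hUV, ?_⟩
  have h2 : ∫ ω, (u ω - c ω * ξ ω) ^ 2 ∂P =
      (∫ ω, u ω ^ 2 ∂P) + (∫ ω, c ω ^ 2 ∂P) * ∫ ω, ξ ω ^ 2 ∂P := by
    have e : ∀ ω, (u ω - c ω * ξ ω) ^ 2 =
        u ω ^ 2 - 2 * (u ω * c ω * ξ ω) + c ω ^ 2 * ξ ω ^ 2 := fun ω => by ring
    have hd : Integrable (fun ω => u ω ^ 2 - 2 * (u ω * c ω * ξ ω)) P :=
      hu2.integrable_sq.sub (hucξ.const_mul 2)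
    simp only [e]
    rw [integral_add hd hcξ2,
      integral_sub hu2.integrable_sq (hucξ.const_mul 2), integral_const_mul,
      hi1.integral_fun_mul_eq_mul_integral huc.aestronglyMeasurable hξs,
      (hi 2).integral_fun_mul_eq_mul_integral hc2.integrable_sq.aestronglyMeasurable
        hξsq.aestronglyMeasurable, hξmean]
    ring
  have hN : (∫ ω, (u ω - c ω * ξ ω) ^ 8 ∂P) ^ (1 / 8 : ℝ) ≤ √7 ^ l * √(∫ ω, u ω ^ 2 ∂P) +
      √7 ^ l * √(∫ ω, c ω ^ 2 ∂P) * (∫ ω, ξ ω ^ 8 ∂P) ^ (1 / 8 : ℝ) := by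
    have hle : lpNorm (fun ω => u ω - c ω * ξ ω) 8 P ≤
        lpNorm u 8 P + lpNorm (fun ω => c ω * ξ ω) 8 P := lpNorm_sub_le hu (by norm_num)
    rw [lpNorm_eight_eq hUV.aestronglyMeasurable, lpNorm_eight_eq hu.aestronglyMeasurable,
      lpNorm_eight_eq hV.aestronglyMeasurable] at hle
    refine hle.trans (add_le_add (rpow_one_eighth_le_of_le (integral_pow_eight_nonneg _)
      (integral_sq_nonneg _) hul) ?_)
    simp only [mul_pow]
    rw [(hi 8).integral_fun_mul_eq_mul_integral hc8.aestronglyMeasurable hξ8.aestronglyMeasurable,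
      Real.mul_rpow (integral_pow_eight_nonneg _) (integral_pow_eight_nonneg _)]
    exact mul_le_mul_of_nonneg_right (rpow_one_eighth_le_of_le (integral_pow_eight_nonneg _)
      (integral_sq_nonneg _) hcl) (Real.rpow_nonneg (integral_pow_eight_nonneg _) _)
  rw [h2]
  refine div_rpow_half_le (integral_sq_nonneg _) (integral_sq_nonneg _) (by positivity) hξ2 ?_ hN
  -- Jensen's inequality, after an eighth root, gives `‖ξ‖₂ ≤ ‖ξ‖₈`.
  have h := Real.rpow_le_rpow (by positivity) (integral_sq_pow_four_le hξs hξ8)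
    (by norm_num : (0 : ℝ) ≤ 1 / 8)
  rwa [← Real.rpow_natCast, ← Real.rpow_mul hξ2.le,
    show ((4 : ℕ) : ℝ) * (1 / 8) = 1 / 2 by norm_num, ← Real.sqrt_eq_rpow] at h

end

/-! ### The residual of the multi-index model -/

lemma memLp_eight_eval_of_hasLaw {Ω : Type*} [MeasurableSpace Ω] {P : Measure Ω} {d : ℕ}
    {S : Matrix (Fin d) (Fin d) ℝ} {x : Ω → EuclideanSpace ℝ (Fin d)}
    (hx : HasLaw x (multivariateGaussian 0 S) P) (p : MvPolynomial (Fin d) ℝ) :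
    MemLp (fun ω => MvPolynomial.eval (x ω).ofLp p) 8 P :=
  memLp_eight_of_integrable (integrable_eval_of_hasLaw hx p).aestronglyMeasurable
    ((integrable_eval_of_hasLaw hx (p ^ 8)).congr (.of_forall fun _ => map_pow _ p 8))

/-- The linear form `⟨w, ·⟩` as a polynomial in the coordinates. -/
noncomputable def innerPolynomial {d : ℕ} (w : EuclideanSpace ℝ (Fin d)) :
    MvPolynomial (Fin d) ℝ :=
  ∑ j, MvPolynomial.C (w j) * MvPolynomial.X j

lemma eval_innerPolynomial {d : ℕ} (w v : EuclideanSpace ℝ (Fin d)) :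
    MvPolynomial.eval v.ofLp (innerPolynomial w) = inner ℝ w v := by
  simp [innerPolynomial, PiLp.inner_apply, mul_comm]

lemma totalDegree_innerPolynomial_le {d : ℕ} (w : EuclideanSpace ℝ (Fin d)) :
    (innerPolynomial w).totalDegree ≤ 1 :=
  MvPolynomial.totalDegree_finsetSum_le fun _ _ => (MvPolynomial.totalDegree_mul _ _).trans (by simp)

lemma eval_aeval_innerPolynomial {d k : ℕ} (wstar : Fin k → EuclideanSpace ℝ (Fin d))
    (m : MvPolynomial (Fin k) ℝ) (v : EuclideanSpace ℝ (Fin d)) :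
    MvPolynomial.eval v.ofLp (MvPolynomial.aeval (fun i => innerPolynomial (wstar i)) m) =
      MvPolynomial.eval (fun i => inner ℝ (wstar i) v) m := by
  simp only [← eval_innerPolynomial, ← MvPolynomial.coe_aeval_eq_eval, RingHom.coe_coe,
    ← AlgHom.comp_apply, MvPolynomial.comp_aeval]

theorem mainTheorem12 {Ω : Type*} [MeasurableSpace Ω] (P : Measure Ω) [IsProbabilityMeasure P]
    {d k : ℕ} (S : Matrix (Fin d) (Fin d) ℝ) (wstar : Fin k → EuclideanSpace ℝ (Fin d))
    (m s : MvPolynomial (Fin k) ℝ) (l : ℕ) (hl : 1 ≤ l)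
    (hm : m.totalDegree ≤ l) (hs : s.totalDegree ≤ l)
    (x : Ω → EuclideanSpace ℝ (Fin d)) (ξ y : Ω → ℝ)
    (hmodel : IsMultiIndexModel P S wstar
      (fun η z => MvPolynomial.eval η m + MvPolynomial.eval η s * z) x ξ y)
    (hξ8 : Integrable (fun ω => ξ ω ^ 8) P)
    (hξmean : ∫ ω, ξ ω ∂P = 0)
    (hξ2 : 0 < ∫ ω, ξ ω ^ 2 ∂P)
    (w : EuclideanSpace ℝ (Fin d)) (b : ℝ) :
    MemLp (fun ω => inner ℝ w (x ω) + b - y ω) 8 P ∧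
      (∫ ω, (inner ℝ w (x ω) + b - y ω) ^ 8 ∂P) ^ (1 / 8 : ℝ) /
          (∫ ω, (inner ℝ w (x ω) + b - y ω) ^ 2 ∂P) ^ (1 / 2 : ℝ) ≤
        √2 * √7 ^ l *
          ((∫ ω, ξ ω ^ 8 ∂P) ^ (1 / 8 : ℝ) / (∫ ω, ξ ω ^ 2 ∂P) ^ (1 / 2 : ℝ)) := by
  -- The linear form has degree up to 1; this is where `1 ≤ l` enters.
  have hdeg : (innerPolynomial w + MvPolynomial.C b -
      MvPolynomial.aeval (fun i => innerPolynomial (wstar i)) m).totalDegree ≤ l := by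
    refine (MvPolynomial.totalDegree_sub _ _).trans (max_le
      ((MvPolynomial.totalDegree_add _ _).trans (max_le
        ((totalDegree_innerPolynomial_le w).trans hl) (by simp)))
      (MvPolynomial.totalDegree_aeval_le hm fun i => totalDegree_innerPolynomial_le _))
  have hdeg' : (MvPolynomial.aeval (fun i => innerPolynomial (wstar i)) s).totalDegree ≤ l :=
    MvPolynomial.totalDegree_aeval_le hs fun i => totalDegree_innerPolynomial_le (wstar i)
  have key := memLp_and_ratio_le_of_indepFun (memLp_eight_eval_of_hasLaw hmodel.law_x _)
    (memLp_eight_eval_of_hasLaw hmodel.law_x _) hmodel.aemeasurable_noise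
    (hmodel.indep.comp (ψ := id) ((MvPolynomial.measurable_eval_ofLp _).prodMk
      (MvPolynomial.measurable_eval_ofLp _)) measurable_id) hξ8 hξmean hξ2
    (integral_eval_pow_eight_le_of_hasLaw hmodel.law_x hdeg)
    (integral_eval_pow_eight_le_of_hasLaw hmodel.law_x hdeg')
  have hae : (fun ω => MvPolynomial.eval (x ω).ofLp (innerPolynomial w + MvPolynomial.C b -
      MvPolynomial.aeval (fun i => innerPolynomial (wstar i)) m) -
      MvPolynomial.eval (x ω).ofLp (MvPolynomial.aeval (fun i => innerPolynomial (wstar i)) s) * ξ ω)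
      =ᵐ[P] fun ω => inner ℝ w (x ω) + b - y ω := by
    filter_upwards [hmodel.label_eq] with ω hω
    rw [hω, map_sub, map_add, MvPolynomial.eval_C, eval_innerPolynomial,
      eval_aeval_innerPolynomial, eval_aeval_innerPolynomial]
    ring
  refine ⟨(memLp_congr_ae hae).1 key.1, ?_⟩
  have hi : ∀ n : ℕ, ∫ ω, (inner ℝ w (x ω) + b - y ω) ^ n ∂P = _ := fun n =>
    (integral_congr_ae (hae.fun_comp (· ^ n))).symm
  rw [hi 8, hi 2]
  exact key.2
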